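/- Let $n\ge 1$, $\lambda>0$, and let $\mu_\lambda$ be the outer measure on $\mathbb{R}^n$ given by $$\mu_\lambda(E)=\inf\Big\{\sum_i h_\lambda(\operatorname{diam}U_i)\;:\;E\subset\bigcup_i U_i\Big\},\qquad h_\lambda(0)=0,\quad h_\lambda(r)=r^n+\lambda r^{n-1}\ (r>0),$$ the infimum being over all countable covers of $E$ by subsets $U_i$ of $\mathbb{R}^n$ (sets of infinite diameter cost $\infty$). For $M\ge 0$ and $N\in\mathbb{N}$, say that a bounded open set $\Omega\subset\mathbb{R}^n$ is Lipschitz with character $(M,N)$ if there are points $x_1,\dots,x_N\in\partial\Omega$ and radii $r_1,\dots,r_N>0$ with $\partial\Omega\subset\bigcup_{i=1}^N B(x_i,r_i)$ such that, for each $i$, in suitable Cartesian coordinates $(y',y_n)\in\mathbb{R}^{n-1}\times\mathbb{R}$ (depending on $i$) the set $\Omega\cap B(x_i,r_i)$ equals $\{y_n>\varphi_i(y')\}\cap B(x_i,r_i)$ for some function $\varphi_i:\mathbb{R}^{n-1}\to\mathbb{R}$ with Lipschitz constant at most $M$. (Every bounded Lipschitz domain has such a character, by compactness of its boundary.) Then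 for all $n\ge1$, $M\ge 0$ and $N\in\mathbb{N}$ there are constants $c,C>0$, depending only on $n$, $M$ and $N$, such that for every bounded open set $\Omega\subset\mathbb{R}^n$ that is Lipschitz with character $(M,N)$ and every $\lambda>0$, $$c\,\big(|\Omega|+\lambda\,\mathcal{H}^{n-1}(\partial\Omega)\big)\;\le\;\mu_\lambda(\Omega)\;\le\;C\,\big(|\Omega|+\lambda\,\mathcal{H}^{n-1}(\partial\Omega)\big),$$ where $|\cdot|$ is Lebesgue measure and $\mathcal{H}^{n-1}$ is $(n-1)$-dimensional Hausdorff measure. -/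

import Mathlib

open MeasureTheory Set
open scoped ENNReal NNReal

noncomputable section

/-- The Carathéodory outer measure of a gauge `h` with `h 0 = 0`:
`E ↦ inf { ∑ i, h (diam (U i)) : E ⊆ ⋃ i, U i }`, the infimum being over all countable covers of `E`
by arbitrary sets (finite covers are padded with empty sets, which cost `h 0 = 0`). -/
def caratheodoryOuterMeasure {X : Type*} [PseudoEMetricSpace X] (h : ℝ≥0∞ → ℝ≥0∞) (h0 : h 0 = 0) :
    OuterMeasure X :=
  OuterMeasure.ofFunction (fun U : Set X => h (Metric.ediam U)) (by simp [h0])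

/-- The mixed gauge `h(r) = r ^ n + lam * r ^ (n - 1)`, with `h(0) = 0`. (The value at `0` has to be
prescribed only for `n = 1`, where `r ^ (n - 1) = 1` for all `r > 0`.) For `n ≥ 1` its value
at `r = ∞`, the cost of an unbounded set, is `∞`. -/
def mixedGauge (n : ℕ) (lam : ℝ) (r : ℝ≥0∞) : ℝ≥0∞ :=
  if r = 0 then 0 else r ^ n + ENNReal.ofReal lam * r ^ (n - 1)

theorem mixedGauge_zero (n : ℕ) (lam : ℝ) : mixedGauge n lam 0 = 0 := by
  simp [mixedGauge]

/-- The mixed-gauge outer measure `μ_lam` on `ℝⁿ` with the Euclidean metric. -/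
def mixedMeasure (n : ℕ) (lam : ℝ) : OuterMeasure (EuclideanSpace ℝ (Fin n)) :=
  caratheodoryOuterMeasure (mixedGauge n lam) (mixedGauge_zero n lam)

/-- `Ω` coincides in the ball `B(x, r)` with the region above the graph of an `M`-Lipschitz function
`φ : ℝⁿ⁻¹ → ℝ`, in the Cartesian coordinates `(y', yₙ) ∈ ℝⁿ⁻¹ × ℝ` given by a rigid motion `e`
(the product carries the Euclidean norm). -/
def IsLipschitzEpigraphIn {n : ℕ} (M : ℝ≥0) (Ω : Set (EuclideanSpace ℝ (Fin n)))
    (x : EuclideanSpace ℝ (Fin n)) (r : ℝ) : Prop :=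
  ∃ (e : EuclideanSpace ℝ (Fin n) ≃ᵢ WithLp 2 (EuclideanSpace ℝ (Fin (n - 1)) × ℝ))
    (φ : EuclideanSpace ℝ (Fin (n - 1)) → ℝ),
    LipschitzWith M φ ∧ ∀ y ∈ Metric.ball x r, y ∈ Ω ↔ φ (e y).fst < (e y).snd

/-- `Ω` is a bounded Lipschitz (not necessarily connected) open set of Lipschitz character `(M, N)`:
its boundary is covered by `N` balls centred on the boundary, in each of which `Ω` is, up to a rigid
motion, the region above the graph of an `M`-Lipschitz function. The radii of the balls are
arbitrary, so that the character is invariant under scaling. A bounded Lipschitz open set, in the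
sense that every boundary point has such a ball around it, has some character `(M, N)`, because its
boundary is compact. -/
structure IsBoundedLipschitz {n : ℕ} (M : ℝ≥0) (N : ℕ) (Ω : Set (EuclideanSpace ℝ (Fin n))) :
    Prop where
  isOpen : IsOpen Ω
  isBounded : Bornology.IsBounded Ω
  exists_charts : ∃ (x : Fin N → EuclideanSpace ℝ (Fin n)) (r : Fin N → ℝ),
    (∀ i, x i ∈ frontier Ω ∧ 0 < r i ∧ IsLipschitzEpigraphIn M Ω (x i) (r i)) ∧
    frontier Ω ⊆ ⋃ i, Metric.ball (x i) (r i)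

end

/-! Upper bound: the fraction of a cube around a point of `Ω` that `Ω` fills is one for small cubes
and tends to zero for large ones, so some cube `Q` is filled neither too little nor more than half.
Then the volume of `Q` is controlled by `|Ω ∩ Q|` and, by the relative isoperimetric inequality
`volume_inter_mul_volume_diff_le`, its surface area by the boundary inside `Q`. Vitali's lemma
selects disjoint cubes whose enlargements cover `Ω`, and both estimates add up.

The isoperimetric inequality moves one random point of `Q` to another by changing one coordinate at
a time. A walk that leaves `A` crosses the boundary on a segment parallel to some axis, so its
probability is at most the total normalised measure of the coordinate projections of the boundary.

Lower bound: volume is at most `∑ diam ^ n` for any cover. In a chart, vertical lines enter `Ω`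
immediately above boundary points, so the projections of the covering sets cover that of the
boundary piece (`volume_image_fst_le`). The piece is a Lipschitz graph over its projection; summing
over the `N` charts finishes. -/

/-! ### Relative isoperimetric inequality in cubes. -/

section RelativeIsoperimetric

/-- A preconnected set which meets `A` and its complement meets the frontier of `A`. -/
theorem IsPreconnected.inter_frontier_nonempty_of_mem {X : Type*} [TopologicalSpace X]
    {s A : Set X} (hs : IsPreconnected s) {x y : X} (hx : x ∈ s) (hxA : x ∈ A) (hy : y ∈ s)
    (hyA : y ∉ A) : (s ∩ frontier A).Nonempty := by
  by_contra h
  have hsub : s ⊆ interior A ∪ interior Aᶜ := by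
    intro z hz
    by_contra hz'
    rw [mem_union, not_or] at hz'
    refine h ⟨z, hz, ?_, hz'.1⟩
    rw [interior_compl] at hz'
    exact not_not.1 hz'.2
  obtain ⟨z, -, hz1, hz2⟩ := hs _ _ isOpen_interior isOpen_interior hsub
    ⟨x, hx, (hsub hx).resolve_right fun h' => interior_subset h' hxA⟩
    ⟨y, hy, (hsub hy).resolve_left fun h' => hyA (interior_subset h')⟩
  exact interior_subset hz2 (interior_subset hz1)

/-- If `x` and `y` are independent with law `∏ μ i`, then so is every vector each of whose
coordinates is taken from either `x` or `y`. -/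
theorem measurePreserving_hybrid {ι : Type*} [Fintype ι] (μ : ι → Measure ℝ)
    [∀ i, IsProbabilityMeasure (μ i)] (p : ι → Prop) [DecidablePred p] :
    MeasurePreserving (fun (q : (ι → ℝ) × (ι → ℝ)) j => if p j then q.2 j else q.1 j)
      ((Measure.pi μ).prod (Measure.pi μ)) (Measure.pi μ) := by
  have hm : Measurable fun (q : (ι → ℝ) × (ι → ℝ)) j => if p j then q.2 j else q.1 j := by
    refine measurable_pi_lambda _ fun j => ?_
    split_ifs <;> fun_prop
  refine ⟨hm, (Measure.pi_eq fun s hs => ?_).symm⟩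
  rw [Measure.map_apply hm (MeasurableSet.univ_pi hs)]
  have : (fun (q : (ι → ℝ) × (ι → ℝ)) j => if p j then q.2 j else q.1 j) ⁻¹' univ.pi s =
      (univ.pi fun j => if p j then univ else s j) ×ˢ
        (univ.pi fun j => if p j then s j else univ) := by
    ext q
    simp only [mem_preimage, mem_pi, mem_univ, true_imp_iff, mem_prod, ← forall_and]
    refine forall_congr' fun j => ?_
    split_ifs <;> simp
  rw [this, Measure.prod_prod, Measure.pi_pi, Measure.pi_pi, ← Finset.prod_mul_distrib]
  refine Finset.prod_congr rfl fun j _ => ?_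
  split_ifs <;> simp

theorem measurePreserving_removeNth {m : ℕ} (μ : Fin (m + 1) → Measure ℝ)
    [∀ i, IsProbabilityMeasure (μ i)] (k : Fin (m + 1)) :
    MeasurePreserving (fun (z : Fin (m + 1) → ℝ) i => z (k.succAbove i)) (Measure.pi μ)
      (Measure.pi fun i => μ (k.succAbove i)) :=
  measurePreserving_snd.comp (measurePreserving_piFinSuccAbove μ k)

/-- If changing the `k`-th coordinate within `Q` affects membership in `A` only on lines over `S k`,
then `A` and its complement are nearly trivial as soon as all the `S k` are small. -/
theorem measure_mul_measure_compl_le_sum {m : ℕ} (μ : Fin (m + 1) → Measure ℝ)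
    [∀ i, IsProbabilityMeasure (μ i)] {I : Fin (m + 1) → Set ℝ}
    {A : Set (Fin (m + 1) → ℝ)} (S : Fin (m + 1) → Set (Fin m → ℝ))
    (hS : ∀ k, MeasurableSet (S k))
    (h : ∀ k, ∀ z ∈ univ.pi I, ∀ w ∈ univ.pi I, z ∈ A → w ∉ A →
      (∀ j, j ≠ k → z j = w j) → (fun i => z (k.succAbove i)) ∈ S k) :
    Measure.pi μ (A ∩ univ.pi I) * Measure.pi μ (univ.pi I \ A) ≤
      ∑ k, Measure.pi (fun i => μ (k.succAbove i)) (S k) := by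
  -- The walk from `q.1` to `q.2`: after `l` steps the first `l` coordinates have been replaced.
  set hyb : ℕ → (Fin (m + 1) → ℝ) × (Fin (m + 1) → ℝ) → Fin (m + 1) → ℝ :=
    fun l q j => if (j : ℕ) < l then q.2 j else q.1 j with hyb_def
  have hpres : ∀ k : Fin (m + 1), MeasurePreserving (fun q i => hyb k q (k.succAbove i))
      ((Measure.pi μ).prod (Measure.pi μ)) (Measure.pi fun i => μ (k.succAbove i)) := fun k =>
    (measurePreserving_removeNth μ k).comp (measurePreserving_hybrid μ fun j => (j : ℕ) < k)
  have hsub : (A ∩ univ.pi I) ×ˢ (univ.pi I \ A) ⊆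
      ⋃ k : Fin (m + 1), (fun q i => hyb k q (k.succAbove i)) ⁻¹' S k := by
    rintro q ⟨⟨hqA, hqI⟩, hqI', hqA'⟩
    have hmem : ∀ l, hyb l q ∈ univ.pi I := by
      intro l j _
      simp only [hyb_def]
      split_ifs
      exacts [hqI' j trivial, hqI j trivial]
    have h0 : hyb 0 q ∈ A := by simpa [hyb_def] using hqA
    have hlast : hyb (m + 1) q ∉ A := by
      simpa only [hyb_def, Fin.is_lt, if_true] using hqA'
    have hex : ∃ l, hyb l q ∉ A := ⟨_, hlast⟩
    classical
    -- The first exit from `A`; the step leading to it changes only coordinate `k = l - 1`.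
    set l := Nat.find hex with hl
    have hl0 : l ≠ 0 := fun h' => Nat.find_spec hex (by rw [← hl, h']; exact h0)
    obtain ⟨k, hk⟩ := Nat.exists_eq_succ_of_ne_zero hl0
    have hkm : k < m + 1 := by
      have := Nat.find_min' hex hlast
      omega
    have hkA : hyb k q ∈ A := by
      by_contra h'
      have := Nat.find_min' hex h'
      omega
    have hkA' : hyb (k + 1) q ∉ A := by
      have := Nat.find_spec hex
      rwa [← hl, hk] at this
    refine mem_iUnion.2 ⟨⟨k, hkm⟩, h ⟨k, hkm⟩ _ (hmem k) _ (hmem (k + 1)) hkA hkA' ?_⟩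
    intro j hj
    have : (j : ℕ) ≠ k := fun h' => hj (Fin.ext h')
    simp only [hyb_def]
    split_ifs <;> first | rfl | omega
  calc Measure.pi μ (A ∩ univ.pi I) * Measure.pi μ (univ.pi I \ A)
      = ((Measure.pi μ).prod (Measure.pi μ)) ((A ∩ univ.pi I) ×ˢ (univ.pi I \ A)) :=
        (Measure.prod_prod _ _).symm
    _ ≤ _ := measure_mono hsub
    _ ≤ ∑' k : Fin (m + 1), ((Measure.pi μ).prod (Measure.pi μ))
          ((fun q i => hyb k q (k.succAbove i)) ⁻¹' S k) := measure_iUnion_le _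
    _ = _ := by
        rw [tsum_fintype]
        exact Finset.sum_congr rfl fun k _ =>
          (hpres k).measure_preimage (hS k).nullMeasurableSet

theorem closedBall_eq_univ_pi_Icc {k : ℕ} (x : Fin k → ℝ) {r : ℝ} (hr : 0 ≤ r) :
    Metric.closedBall x r = univ.pi fun j => Icc (x j - r) (x j + r) := by
  simp only [closedBall_pi x hr, Real.closedBall_eq_Icc]

theorem pi_smul_restrict_Icc {k : ℕ} (x : Fin k → ℝ) {r : ℝ} (hr : 0 ≤ r) (c : ℝ≥0∞)
    (hc : c ≠ ∞) :
    Measure.pi (fun j => c • (volume : Measure ℝ).restrict (Icc (x j - r) (x j + r))) =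
      c ^ k • volume.restrict (Metric.closedBall x r) := by
  lift c to ℝ≥0 using hc
  have : ∀ j, IsFiniteMeasure ((c : ℝ≥0∞) •
      (volume : Measure ℝ).restrict (Icc (x j - r) (x j + r))) := fun j =>
    inferInstanceAs (IsFiniteMeasure (c • _))
  refine Measure.pi_eq fun s hs => ?_
  rw [closedBall_eq_univ_pi_Icc x hr, volume_pi, Measure.restrict_pi_pi]
  simp [Measure.pi_pi, Finset.prod_mul_distrib]

/-- A relative isoperimetric inequality in cubes, for the Hausdorff measure of the topological
boundary. -/
theorem volume_inter_mul_volume_diff_le {m : ℕ} (A : Set (Fin (m + 1) → ℝ))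
    (x : Fin (m + 1) → ℝ) {r : ℝ} (hr : 0 < r) :
    volume (A ∩ Metric.closedBall x r) * volume (Metric.closedBall x r \ A) ≤
      (m + 1) * ENNReal.ofReal (2 * r) ^ (m + 2) *
        Measure.hausdorffMeasure m (frontier A ∩ Metric.closedBall x r) := by
  set L := ENNReal.ofReal (2 * r) with hL
  have hL0 : L ≠ 0 := by simp [hL, hr]
  have hLt : L ≠ ∞ := ENNReal.ofReal_ne_top
  have hLi : L⁻¹ ≠ ∞ := ENNReal.inv_ne_top.2 hL0
  set Q := Metric.closedBall x r with hQ
  set F := frontier A ∩ Q with hF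
  have hFc : IsCompact F := (isCompact_closedBall x r).inter_left isClosed_frontier
  set μ : Fin (m + 1) → Measure ℝ := fun j =>
    L⁻¹ • (volume : Measure ℝ).restrict (Icc (x j - r) (x j + r)) with hμ
  have : ∀ j, IsProbabilityMeasure (μ j) := fun j => ⟨by
    simp only [hμ, Measure.smul_apply, Measure.restrict_apply_univ, Real.volume_Icc, smul_eq_mul]
    rw [show x j + r - (x j - r) = 2 * r by ring]
    exact ENNReal.inv_mul_cancel hL0 hLt⟩
  set π : Fin (m + 1) → (Fin (m + 1) → ℝ) → Fin m → ℝ := fun k z i => z (k.succAbove i) with hπ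
  have hπL : ∀ k, LipschitzWith 1 (π k) := fun k => LipschitzWith.of_dist_le_mul fun y z => by
    rw [NNReal.coe_one, one_mul, dist_pi_le_iff dist_nonneg]
    exact fun i => dist_le_pi_dist y z _
  have hmain := measure_mul_measure_compl_le_sum μ (I := fun j => Icc (x j - r) (x j + r)) (A := A)
    (fun k => π k '' F) (fun k => (hFc.image (hπL k).continuous).measurableSet) ?_
  · rw [← closedBall_eq_univ_pi_Icc x hr.le, ← hQ, hμ, pi_smul_restrict_Icc x hr.le _ hLi] at hmain
    simp only [Measure.smul_apply, smul_eq_mul] at hmain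
    rw [Measure.restrict_eq_self _ inter_subset_right,
      Measure.restrict_eq_self _ sdiff_subset] at hmain
    have hterm : ∀ k : Fin (m + 1), Measure.pi (fun i => μ (k.succAbove i)) (π k '' F) ≤
        L⁻¹ ^ m * Measure.hausdorffMeasure m F := by
      intro k
      have := pi_smul_restrict_Icc (fun i => x (k.succAbove i)) hr.le _ hLi
      simp only [hμ]
      rw [this, Measure.smul_apply, smul_eq_mul]
      gcongr
      refine (Measure.restrict_apply_le _ _).trans ?_
      rw [← hausdorffMeasure_pi_real, Fintype.card_fin]
      simpa using (hπL k).hausdorffMeasure_image_le (d := m) (by positivity) F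
    have h2 := hmain.trans (Finset.sum_le_sum fun k _ => hterm k)
    rw [Finset.sum_const, Finset.card_univ, Fintype.card_fin, nsmul_eq_mul] at h2
    have hLL : ∀ j : ℕ, L ^ j * L⁻¹ ^ j = 1 := fun j => by
      rw [← mul_pow, ENNReal.mul_inv_cancel hL0 hLt, one_pow]
    -- Undoing the normalisation: two factors `L ^ (m + 1)` from the volumes against one `L ^ m`
    -- from the projections leave `L ^ (m + 2)`.
    calc volume (A ∩ Q) * volume (Q \ A)
        = (L ^ (m + 1) * L⁻¹ ^ (m + 1)) * (L ^ (m + 1) * L⁻¹ ^ (m + 1)) *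
          (volume (A ∩ Q) * volume (Q \ A)) := by rw [hLL]; simp
      _ = L ^ (2 * m + 2) * (L⁻¹ ^ (m + 1) * volume (A ∩ Q) * (L⁻¹ ^ (m + 1) * volume (Q \ A))) := by
          ring
      _ ≤ L ^ (2 * m + 2) * (((m + 1 : ℕ) : ℝ≥0∞) *
          (L⁻¹ ^ m * Measure.hausdorffMeasure m F)) := by gcongr
      _ = (L ^ m * L⁻¹ ^ m) * ((m + 1) * L ^ (m + 2) * Measure.hausdorffMeasure m F) := by
          push_cast; ring
      _ = _ := by rw [hLL, one_mul]
  · intro k z hz w hw hzA hwA hzw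
    rw [← closedBall_eq_univ_pi_Icc x hr.le, ← hQ] at hz hw
    -- The segment from `z` to `w` is parallel to axis `k`, so the boundary point on it has the same
    -- projection as `z`.
    have hconv : Convex ℝ Q := convex_closedBall x r
    obtain ⟨y, hy, hyF⟩ := (convex_segment (𝕜 := ℝ) z w).isPreconnected.inter_frontier_nonempty_of_mem
      (left_mem_segment ℝ z w) hzA (right_mem_segment ℝ z w) hwA
    refine ⟨y, ⟨hyF, hconv.segment_subset hz hw hy⟩, ?_⟩
    obtain ⟨a, b, -, -, hab, rfl⟩ := hy
    funext i
    simp only [hπ, Pi.add_apply, Pi.smul_apply, smul_eq_mul, ← hzw _ (Fin.succAbove_ne k i)]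
    rw [← add_mul, hab, one_mul]

end RelativeIsoperimetric

/-! ### Covering by balanced cubes: the upper bound. -/

section UpperBound

theorem mixedGauge_le {n : ℕ} {lam : ℝ} {r D : ℝ≥0∞} (h : r ≤ D) :
    mixedGauge n lam r ≤ D ^ n + ENNReal.ofReal lam * D ^ (n - 1) := by
  unfold mixedGauge
  split_ifs
  · exact zero_le
  · gcongr

theorem mixedMeasure_le_mixedGauge_ediam (n : ℕ) (lam : ℝ) (U : Set (EuclideanSpace ℝ (Fin n))) :
    mixedMeasure n lam U ≤ mixedGauge n lam (Metric.ediam U) := by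
  unfold mixedMeasure caratheodoryOuterMeasure
  exact OuterMeasure.ofFunction_le (m := fun U => mixedGauge n lam (Metric.ediam U)) U

/-- Each point of a bounded open set is the centre of a cube of which the set occupies neither too
little nor more than one half. -/
theorem exists_closedBall_balanced {m : ℕ} {A : Set (Fin (m + 1) → ℝ)} (hA : IsOpen A)
    (hb : Bornology.IsBounded A) {x : Fin (m + 1) → ℝ} (hx : x ∈ A) :
    ∃ r : ℝ, 0 < r ∧
      volume (Metric.closedBall x r) ≤ 2 ^ (m + 2) * volume (A ∩ Metric.closedBall x r) ∧
      volume (Metric.closedBall x r) ≤ 2 * volume (Metric.closedBall x r \ A) := by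
  obtain ⟨r₀, hr₀, hball⟩ := Metric.nhds_basis_closedBall.mem_iff.1 (hA.mem_nhds hx)
  have hvol : ∀ k : ℕ, volume (Metric.closedBall x (r₀ * 2 ^ k)) =
      ENNReal.ofReal ((2 * (r₀ * 2 ^ k)) ^ (m + 1)) := fun k => by
    rw [Real.volume_pi_closedBall x (by positivity), Fintype.card_fin]
  have hfin : ∀ k : ℕ, volume (Metric.closedBall x (r₀ * 2 ^ k)) ≠ ∞ := fun k => by
    rw [hvol]; exact ENNReal.ofReal_ne_top
  have hAfin : volume A ≠ ∞ := hb.measure_lt_top.ne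
  -- The first dyadic radius with filling at most one half is used. The `max 1` makes the side at
  -- least `1`, so that it is bounded by its own power.
  have hex : ∃ k : ℕ, 2 * volume (A ∩ Metric.closedBall x (r₀ * 2 ^ k)) ≤
      volume (Metric.closedBall x (r₀ * 2 ^ k)) := by
    obtain ⟨k, hk⟩ := pow_unbounded_of_one_lt (max 1 (2 * (volume A).toReal) / (2 * r₀))
      (one_lt_two : (1 : ℝ) < 2)
    rw [div_lt_iff₀ (by positivity)] at hk
    have h1 : max 1 (2 * (volume A).toReal) < 2 * (r₀ * 2 ^ k) := by linarith
    refine ⟨k, ?_⟩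
    calc 2 * volume (A ∩ Metric.closedBall x (r₀ * 2 ^ k)) ≤ 2 * volume A := by
          gcongr; exact inter_subset_left
      _ = ENNReal.ofReal (2 * (volume A).toReal) := by
          rw [ENNReal.ofReal_mul two_pos.le, ENNReal.ofReal_toReal hAfin]; simp
      _ ≤ ENNReal.ofReal ((2 * (r₀ * 2 ^ k)) ^ (m + 1)) := by
          refine ENNReal.ofReal_le_ofReal (((le_max_right _ _).trans h1.le).trans ?_)
          exact le_self_pow₀ ((le_max_left _ _).trans h1.le) m.succ_ne_zero
      _ = _ := (hvol k).symm
  classical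
  have h0 : Nat.find hex ≠ 0 := by
    intro h
    have hs := Nat.find_spec hex
    rw [h, pow_zero, mul_one, inter_eq_self_of_subset_right hball] at hs
    have hpos : volume (Metric.closedBall x r₀) ≠ 0 :=
      (Metric.measure_closedBall_pos volume x hr₀).ne'
    have hf : volume (Metric.closedBall x r₀) ≠ ∞ := by simpa using hfin 0
    have := ENNReal.lt_add_right hf hpos
    rw [← two_mul] at this
    exact this.not_ge hs
  obtain ⟨k, hk⟩ := Nat.exists_eq_succ_of_ne_zero h0
  have hspec := Nat.find_spec hex
  have hmin := Nat.find_min hex (m := k) (by omega)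
  rw [hk] at hspec
  refine ⟨r₀ * 2 ^ (k + 1), by positivity, ?_, ?_⟩
  -- The preceding cube is more than half full, and doubling the radius costs `2 ^ (m + 1)`.
  · calc volume (Metric.closedBall x (r₀ * 2 ^ (k + 1)))
        = 2 ^ (m + 1) * volume (Metric.closedBall x (r₀ * 2 ^ k)) := by
          rw [hvol, hvol, show 2 * (r₀ * 2 ^ (k + 1)) = 2 * (2 * (r₀ * 2 ^ k)) by ring,
            mul_pow 2 (2 * (r₀ * 2 ^ k)), ENNReal.ofReal_mul (by positivity)]
          congr 1
          rw [ENNReal.ofReal_pow two_pos.le]; simp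
      _ ≤ 2 ^ (m + 1) * (2 * volume (A ∩ Metric.closedBall x (r₀ * 2 ^ k))) := by
          gcongr; exact (not_le.1 hmin).le
      _ = 2 ^ (m + 2) * volume (A ∩ Metric.closedBall x (r₀ * 2 ^ k)) := by ring
      _ ≤ _ := by
          gcongr
          · exact one_le_two
          · omega
  · set Q := Metric.closedBall x (r₀ * 2 ^ (k + 1))
    have hsum : volume (A ∩ Q) + volume (Q \ A) = volume Q := by
      rw [inter_comm]; exact measure_inter_add_sdiff Q hA.measurableSet
    have hQ : volume Q ≠ ∞ := hfin (k + 1)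
    refine (ENNReal.add_le_add_iff_left hQ).1 ?_
    calc volume Q + volume Q = 2 * volume (A ∩ Q) + 2 * volume (Q \ A) := by
          rw [← two_mul, ← hsum, mul_add]
      _ ≤ volume Q + 2 * volume (Q \ A) := by gcongr

/-- Each point of a bounded open set is the centre of a cube whose volume and whose surface area are
controlled by the part of the set and of its boundary in the cube. -/
theorem exists_closedBall_pow_le {m : ℕ} {A : Set (Fin (m + 1) → ℝ)} (hA : IsOpen A)
    (hb : Bornology.IsBounded A) {x : Fin (m + 1) → ℝ} (hx : x ∈ A) :
    ∃ r : ℝ, 0 < r ∧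
      ENNReal.ofReal (2 * r) ^ (m + 1) ≤
        ((m + 1) * 2 ^ (m + 3)) * volume (A ∩ Metric.closedBall x r) ∧
      ENNReal.ofReal (2 * r) ^ m ≤ ((m + 1) * 2 ^ (m + 3)) *
        Measure.hausdorffMeasure m (frontier A ∩ Metric.closedBall x r) := by
  obtain ⟨r, hr, h1, h2⟩ := exists_closedBall_balanced hA hb hx
  have hQ : volume (Metric.closedBall x r) = ENNReal.ofReal (2 * r) ^ (m + 1) := by
    rw [Real.volume_pi_closedBall x hr.le, Fintype.card_fin, ENNReal.ofReal_pow (by positivity)]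
  have hiso := volume_inter_mul_volume_diff_le A x hr
  rw [hQ] at h1 h2
  set L := ENNReal.ofReal (2 * r) with hL
  have hL0 : L ≠ 0 := by simp [hL, hr]
  have hLt : L ≠ ∞ := ENNReal.ofReal_ne_top
  refine ⟨r, hr, h1.trans ?_, ?_⟩
  · gcongr
    calc (2 : ℝ≥0∞) ^ (m + 2) ≤ 2 ^ (m + 3) := by
          gcongr
          · exact one_le_two
          · omega
      _ = 1 * 2 ^ (m + 3) := (one_mul _).symm
      _ ≤ _ := by gcongr; exact le_add_self
  -- Multiplying the two balance estimates gives `L ^ (2 * m + 2)` on the left; cancelling `L ^ (m +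
  -- 2)` leaves `L ^ m`.
  · refine (ENNReal.mul_le_mul_iff_right (pow_ne_zero (m + 2) hL0) (ENNReal.pow_ne_top hLt)).1 ?_
    calc L ^ (m + 2) * L ^ m = L ^ (m + 1) * L ^ (m + 1) := by ring
      _ ≤ _ := mul_le_mul' h1 h2
      _ = 2 ^ (m + 3) * (volume (A ∩ Metric.closedBall x r) *
          volume (Metric.closedBall x r \ A)) := by ring
      _ ≤ 2 ^ (m + 3) * ((m + 1) * L ^ (m + 2) *
          Measure.hausdorffMeasure m (frontier A ∩ Metric.closedBall x r)) := by gcongr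
      _ = _ := by ring

/-- A bounded open set is covered by countably many cubes whose total volume and surface area are
controlled by the volume of the set and the area of its boundary. -/
theorem exists_countable_cover_closedBall {m : ℕ} {A : Set (Fin (m + 1) → ℝ)} (hA : IsOpen A)
    (hb : Bornology.IsBounded A) :
    ∃ (u : Set (Fin (m + 1) → ℝ)) (r : (Fin (m + 1) → ℝ) → ℝ), u.Countable ∧
      A ⊆ ⋃ x ∈ u, Metric.closedBall x (5 * r x) ∧ (∀ x ∈ u, 0 < r x) ∧
      ∑' x : u, ENNReal.ofReal (2 * r x) ^ (m + 1) ≤ ((m + 1) * 2 ^ (m + 3)) * volume A ∧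
      ∑' x : u, ENNReal.ofReal (2 * r x) ^ m ≤
        ((m + 1) * 2 ^ (m + 3)) * Measure.hausdorffMeasure m (frontier A) := by
  choose! r hr0 hrn hrm using fun x (hx : x ∈ A) => exists_closedBall_pow_le hA hb hx
  set K : ℝ≥0∞ := (m + 1) * 2 ^ (m + 3) with hK
  have hKt : K ≠ ∞ := by
    have : K = (((m + 1) * 2 ^ (m + 3) : ℕ) : ℝ≥0∞) := by rw [hK]; push_cast; rfl
    rw [this]; exact ENNReal.natCast_ne_top _
  have hV : K * volume A ≠ ∞ := ENNReal.mul_ne_top hKt hb.measure_lt_top.ne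
  -- Vitali needs bounded radii; the volume estimate supplies the bound.
  obtain ⟨u, huA, hdisj, hcov⟩ := Vitali.exists_disjoint_subfamily_covering_enlargement_closedBall
    A id r (max 1 (K * volume A).toReal) (fun x hx => by
      by_contra! hlt
      have h1 : 1 ≤ 2 * r x := by linarith [(le_max_left _ _).trans_lt hlt]
      have h2 : (2 * r x) ^ (m + 1) ≤ (K * volume A).toReal := by
        rw [← ENNReal.ofReal_le_iff_le_toReal hV, ENNReal.ofReal_pow (by linarith)]
        exact (hrn x hx).trans (by gcongr; exact inter_subset_left)
      have h3 : 2 * r x ≤ (2 * r x) ^ (m + 1) := le_self_pow₀ h1 m.succ_ne_zero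
      linarith [(le_max_right _ _).trans_lt hlt]) 5 (by norm_num)
  simp only [id] at hdisj hcov
  have hu : u.Countable := hdisj.countable_of_nonempty_interior fun x hx =>
    ⟨x, Metric.ball_subset_interior_closedBall (Metric.mem_ball_self (hr0 x (huA hx)))⟩
  have key : ∀ (ν : Measure (Fin (m + 1) → ℝ)) (B : Set (Fin (m + 1) → ℝ)), MeasurableSet B →
      ∑' x : u, ν (B ∩ Metric.closedBall x (r x)) ≤ ν B := by
    intro ν B hB
    rw [← measure_biUnion hu (f := fun x => B ∩ Metric.closedBall x (r x))
      (hdisj.mono fun x => inter_subset_right)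
      fun x _ => hB.inter Metric.isClosed_closedBall.measurableSet]
    exact measure_mono (iUnion₂_subset fun _ _ => inter_subset_left)
  refine ⟨u, r, hu, fun x hx => ?_, fun x hx => hr0 x (huA hx), ?_, ?_⟩
  · obtain ⟨y, hy, hxy⟩ := hcov x hx
    exact mem_biUnion hy (hxy (Metric.mem_closedBall_self (hr0 x hx).le))
  · calc ∑' x : u, ENNReal.ofReal (2 * r x) ^ (m + 1)
        ≤ ∑' x : u, K * volume (A ∩ Metric.closedBall x (r x)) :=
          ENNReal.tsum_le_tsum fun x => hrn x (huA x.2)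
      _ ≤ _ := by
          rw [ENNReal.tsum_mul_left]
          exact mul_le_mul_right (key _ _ hA.measurableSet) _
  · calc ∑' x : u, ENNReal.ofReal (2 * r x) ^ m
        ≤ ∑' x : u, K * Measure.hausdorffMeasure m (frontier A ∩ Metric.closedBall x (r x)) :=
          ENNReal.tsum_le_tsum fun x => hrm x (huA x.2)
      _ ≤ _ := by
          rw [ENNReal.tsum_mul_left]
          exact mul_le_mul_right (key _ _ isClosed_frontier.measurableSet) _

/-- The cubes are balls of the sup metric; the identity map to it is `1`-Lipschitz, and its inverse
costs a factor `s`. -/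
theorem exists_mixedMeasure_le (m : ℕ) :
    ∃ C : ℝ≥0, 0 < C ∧ ∀ Ω : Set (EuclideanSpace ℝ (Fin (m + 1))), IsOpen Ω →
      Bornology.IsBounded Ω → ∀ lam : ℝ,
        mixedMeasure (m + 1) lam Ω ≤ (C : ℝ≥0∞) * (volume Ω +
          ENNReal.ofReal lam * Measure.hausdorffMeasure m (frontier Ω)) := by
  -- Taking `1 ≤ s` allows both `t ^ m` and `t ^ (m + 1)` to be bounded by the latter, where `t = 5
  -- * s`.
  obtain ⟨s, hs1, hs⟩ : ∃ s : ℝ≥0, 1 ≤ s ∧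
      LipschitzWith s (WithLp.toLp 2 : (Fin (m + 1) → ℝ) → EuclideanSpace ℝ (Fin (m + 1))) :=
    ⟨_, le_max_left _ _, (PiLp.lipschitzWith_toLp 2 _).weaken (le_max_right _ _)⟩
  refine ⟨(5 * s) ^ (m + 1) * ((m + 1) * 2 ^ (m + 3)), by positivity, fun Ω hΩ hb lam => ?_⟩
  set e : EuclideanSpace ℝ (Fin (m + 1)) ≃ₜ (Fin (m + 1) → ℝ) :=
    (EuclideanSpace.equiv (Fin (m + 1)) ℝ).toHomeomorph
  have he1 : LipschitzWith 1 e := PiLp.lipschitzWith_ofLp 2 _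
  have hes : LipschitzWith s e.symm := hs
  have hvol : volume (e '' Ω) = volume Ω := by
    rw [e.image_eq_preimage_symm]
    exact (PiLp.volume_preserving_toLp (Fin (m + 1))).measure_preimage
      hΩ.measurableSet.nullMeasurableSet
  have hH : Measure.hausdorffMeasure m (frontier (e '' Ω)) ≤
      Measure.hausdorffMeasure m (frontier Ω) := by
    rw [← e.image_frontier]
    simpa using he1.hausdorffMeasure_image_le (d := m) (by positivity) (frontier Ω)
  obtain ⟨u, r, hu, hcov, hr, hn, hm⟩ := exists_countable_cover_closedBall
    (e.isOpenMap Ω hΩ) (he1.isBounded_image hb)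
  have hcov' : Ω ⊆ ⋃ x ∈ u, e.symm '' Metric.closedBall x (5 * r x) := by
    intro y hy
    obtain ⟨x, hx, hyx⟩ := mem_iUnion₂.1 (hcov (mem_image_of_mem e hy))
    exact mem_biUnion hx ⟨e y, hyx, e.symm_apply_apply y⟩
  have hdiam : ∀ x : u, Metric.ediam (e.symm '' Metric.closedBall (x : Fin (m + 1) → ℝ) (5 * r x)) ≤
      (5 * s : ℝ≥0) * ENNReal.ofReal (2 * r x) := by
    intro x
    have hx := hr x x.2
    refine (hes.ediam_image_le _).trans ?_
    rw [show ((5 * s : ℝ≥0) : ℝ≥0∞) * ENNReal.ofReal (2 * r x) =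
      s * (2 * (5 * ENNReal.ofReal (r x))) by
        rw [ENNReal.ofReal_mul two_pos.le]; push_cast; simp; ring]
    gcongr
    rw [← Metric.closedEBall_ofReal (by positivity)]
    refine Metric.ediam_closedEBall_le.trans_eq ?_
    rw [ENNReal.ofReal_mul (by norm_num)]
    simp
  have ht1 : (1 : ℝ≥0∞) ≤ (5 * s : ℝ≥0) := by
    rw [← ENNReal.coe_one, ENNReal.coe_le_coe]
    nlinarith [hs1]
  set t : ℝ≥0∞ := ((5 * s : ℝ≥0) : ℝ≥0∞) with ht
  calc mixedMeasure (m + 1) lam Ω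
      ≤ mixedMeasure (m + 1) lam (⋃ x ∈ u, e.symm '' Metric.closedBall x (5 * r x)) :=
        measure_mono hcov'
    _ ≤ ∑' x : u, mixedMeasure (m + 1) lam (e.symm '' Metric.closedBall x (5 * r x)) :=
        measure_biUnion_le _ hu _
    _ ≤ ∑' x : u, ((t * ENNReal.ofReal (2 * r x)) ^ (m + 1) +
          ENNReal.ofReal lam * (t * ENNReal.ofReal (2 * r x)) ^ m) :=
        ENNReal.tsum_le_tsum fun x =>
          (mixedMeasure_le_mixedGauge_ediam _ _ _).trans (mixedGauge_le (hdiam x))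
    _ ≤ ∑' x : u, (t ^ (m + 1) * ENNReal.ofReal (2 * r x) ^ (m + 1) +
          t ^ (m + 1) * (ENNReal.ofReal lam * ENNReal.ofReal (2 * r x) ^ m)) := by
        refine ENNReal.tsum_le_tsum fun x => ?_
        rw [mul_pow, mul_pow, mul_left_comm (ENNReal.ofReal lam)]
        gcongr
        exact m.le_succ
    _ = t ^ (m + 1) * (∑' x : u, ENNReal.ofReal (2 * r x) ^ (m + 1) +
          ENNReal.ofReal lam * ∑' x : u, ENNReal.ofReal (2 * r x) ^ m) := by
        rw [ENNReal.tsum_add, ENNReal.tsum_mul_left, ENNReal.tsum_mul_left, ENNReal.tsum_mul_left,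
          mul_add]
    _ ≤ t ^ (m + 1) * (((m + 1) * 2 ^ (m + 3)) * volume Ω +
          ENNReal.ofReal lam * (((m + 1) * 2 ^ (m + 3)) *
            Measure.hausdorffMeasure m (frontier Ω))) := by
        rw [hvol] at hn
        gcongr
        exact hm.trans (by gcongr)
    _ = _ := by
        rw [ht]; push_cast; ring

end UpperBound

/-! ### Projecting covers along graph charts: the lower bound. -/

section LowerBound

theorem EuclideanSpace.volume_le_ediam_pow {m : ℕ} (U : Set (EuclideanSpace ℝ (Fin m))) :
    volume U ≤ Metric.ediam U ^ m := by
  have h := (PiLp.volume_preserving_toLp (Fin m)).measure_preimage_equiv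
    (f := MeasurableEquiv.toLp 2 (Fin m → ℝ)) U
  rw [← h]
  refine (Real.volume_pi_le_diam_pow _).trans ?_
  rw [Fintype.card_fin]
  gcongr
  rw [← MeasurableEquiv.image_symm]
  have h2 := (PiLp.lipschitzWith_ofLp 2 fun _ : Fin m => ℝ).ediam_image_le U
  rw [ENNReal.coe_one, one_mul] at h2
  exact h2

/-- For the sup metric the two measures coincide, and the change of metric is Lipschitz. -/
theorem EuclideanSpace.exists_hausdorffMeasure_le_volume (m : ℕ) :
    ∃ K : ℝ≥0, ∀ U : Set (EuclideanSpace ℝ (Fin m)),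
      Measure.hausdorffMeasure m U ≤ K * volume U := by
  refine ⟨((Fintype.card (Fin m) : ℝ≥0) ^ ((1 : ℝ≥0∞) / 2).toReal) ^ m, fun U => ?_⟩
  have h := (PiLp.volume_preserving_toLp (Fin m)).measure_preimage_equiv
    (f := MeasurableEquiv.toLp 2 (Fin m → ℝ)) U
  rw [← h, ← hausdorffMeasure_pi_real, Fintype.card_fin]
  have h2 := (PiLp.lipschitzWith_toLp 2 fun _ : Fin m => ℝ).hausdorffMeasure_image_le
    (d := m) (by positivity) (MeasurableEquiv.toLp 2 (Fin m → ℝ) ⁻¹' U)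
  rw [show WithLp.toLp 2 '' (MeasurableEquiv.toLp 2 (Fin m → ℝ) ⁻¹' U) = U from
    (MeasurableEquiv.toLp 2 (Fin m → ℝ)).image_preimage U] at h2
  simpa using h2

theorem mixedGauge_succ (m : ℕ) (lam : ℝ) (r : ℝ≥0∞) :
    mixedGauge (m + 1) lam r = r ^ (m + 1) + ENNReal.ofReal lam * (if r = 0 then 0 else r ^ m) := by
  unfold mixedGauge
  split_ifs with h <;> simp [h]

/-- Where `Ω` is the region above the graph of `φ`, its boundary lies in that graph. -/
theorem snd_eq_of_mem_frontier {X Y : Type*} [TopologicalSpace X] [TopologicalSpace Y]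
    {f : X → ℝ} {π : X → Y} {φ : Y → ℝ} (hf : Continuous f) (hπ : Continuous π) (hφ : Continuous φ)
    {Ω B : Set X} (hΩ : IsOpen Ω) (hB : IsOpen B) (h : ∀ y ∈ B, y ∈ Ω ↔ φ (π y) < f y)
    {y : X} (hy : y ∈ frontier Ω) (hyB : y ∈ B) : f y = φ (π y) := by
  have hyΩ : y ∉ Ω := by
    rw [hΩ.frontier_eq] at hy
    exact hy.2
  refine le_antisymm (not_lt.1 fun hlt => hyΩ ((h y hyB).2 hlt)) (not_lt.1 fun hlt => ?_)
  obtain ⟨z, ⟨hzB, hz⟩, hzΩ⟩ := mem_closure_iff.1 (frontier_subset_closure hy)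
    (B ∩ {z | f z < φ (π z)}) (hB.inter (isOpen_lt hf (hφ.comp hπ))) ⟨hyB, hlt⟩
  exact lt_asymm hz ((h z hzB).1 hzΩ)

theorem volume_image_fst_le {m : ℕ}
    (e : EuclideanSpace ℝ (Fin (m + 1)) ≃ᵢ WithLp 2 (EuclideanSpace ℝ (Fin m) × ℝ))
    {φ : EuclideanSpace ℝ (Fin m) → ℝ} (hφ : Continuous φ)
    {Ω B : Set (EuclideanSpace ℝ (Fin (m + 1)))} (hΩ : IsOpen Ω) (hB : IsOpen B)
    (h : ∀ y ∈ B, y ∈ Ω ↔ φ (e y).fst < (e y).snd)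
    {U : ℕ → Set (EuclideanSpace ℝ (Fin (m + 1)))} (hU : Ω ⊆ ⋃ j, U j) :
    volume ((fun y => (e y).fst) '' (frontier Ω ∩ B)) ≤
      ∑' j, if Metric.ediam (U j) = 0 then 0 else Metric.ediam (U j) ^ m := by
  have hπ : LipschitzWith 1 fun y => (e y).fst := by
    refine LipschitzWith.of_dist_le_mul fun y z => ?_
    rw [NNReal.coe_one, one_mul, ← e.isometry.dist_eq y z]
    have h1 := (WithLp.prod_lipschitzWith_ofLp 2 (EuclideanSpace ℝ (Fin m)) ℝ).dist_le_mul
      (e y) (e z)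
    rw [NNReal.coe_one, one_mul] at h1
    exact (le_max_left _ _).trans h1
  have hf : Continuous fun y => (e y).snd :=
    (WithLp.prod_continuous_ofLp 2 _ _).snd.comp e.continuous
  -- Sets of zero diameter cost nothing and must be discarded; for `m = 0` even a point would
  -- project to positive measure.
  set V : ℕ → Set (EuclideanSpace ℝ (Fin m)) := fun j =>
    if Metric.ediam (U j) = 0 then ∅ else (fun y => (e y).fst) '' U j with hV
  have hsub : (fun y => (e y).fst) '' (frontier Ω ∩ B) ⊆ ⋃ j, V j := by
    rintro _ ⟨y, ⟨hyF, hyB⟩, rfl⟩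
    have hy := snd_eq_of_mem_frontier hf hπ.continuous hφ hΩ hB h hyF hyB
    -- the vertical line through `y`
    set g : ℝ → EuclideanSpace ℝ (Fin (m + 1)) := fun t => e.symm (WithLp.toLp 2 ((e y).fst, t))
    have hg : Continuous g := e.symm.continuous.comp
      ((WithLp.prod_continuous_toLp 2 _ _).comp (by fun_prop))
    have hgi : Function.Injective g := fun s t hst => by
      have := e.symm.injective hst
      simpa using congrArg WithLp.snd this
    have hge : ∀ t, e (g t) = WithLp.toLp 2 ((e y).fst, t) := fun t => e.apply_symm_apply _
    have hgy : g (e y).snd = y := by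
      apply e.injective
      rw [hge]
      rfl
    have hopen : IsOpen (g ⁻¹' B) := hB.preimage hg
    have hmem : (e y).snd ∈ g ⁻¹' B := by rw [mem_preimage, hgy]; exact hyB
    obtain ⟨ε, hε, hball⟩ := Metric.isOpen_iff.1 hopen _ hmem
    have hline : ∀ t ∈ Ioo (e y).snd ((e y).snd + ε), g t ∈ Ω := fun t ht => by
      have htB : g t ∈ B := hball (by
        rw [Metric.mem_ball, Real.dist_eq, abs_lt]
        constructor <;> linarith [ht.1, ht.2])
      rw [h _ htB, hge]
      show φ (e y).fst < t
      rw [← hy]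
      exact ht.1
    -- The discarded sets have at most one point each, so together they cannot cover an interval of
    -- the vertical line.
    have hcount : (g ⁻¹' ⋃ j ∈ {j | Metric.ediam (U j) = 0}, U j).Countable := by
      refine Countable.preimage_of_injOn ?_ hgi.injOn
      refine (to_countable _).biUnion fun j hj => ?_
      exact (Metric.ediam_eq_zero_iff.1 hj).finite.countable
    have hnot : ¬ Ioo (e y).snd ((e y).snd + ε) ⊆
        g ⁻¹' ⋃ j ∈ {j | Metric.ediam (U j) = 0}, U j := fun hs => by
      have := (hcount.mono hs).measure_zero volume
      simp [Real.volume_Ioo, hε.not_ge] at this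
    obtain ⟨t, ht, htn⟩ := not_subset.1 hnot
    obtain ⟨j, hj⟩ := mem_iUnion.1 (hU (hline t ht))
    have hj0 : Metric.ediam (U j) ≠ 0 := fun h0 => htn (mem_biUnion (show j ∈ {j | _} from h0) hj)
    refine mem_iUnion.2 ⟨j, ?_⟩
    simp only [hV, if_neg hj0]
    exact ⟨g t, hj, by simp only [hge]; rfl⟩
  refine (measure_mono hsub).trans ((measure_iUnion_le _).trans (ENNReal.tsum_le_tsum fun j => ?_))
  simp only [hV]
  split_ifs
  · simp
  · refine (EuclideanSpace.volume_le_ediam_pow _).trans ?_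
    gcongr
    simpa using hπ.ediam_image_le (U j)

/-- The boundary piece is contained in the image of its projection `P` under the Lipschitz graph
map, and `P` is measured by the projected cover. -/
theorem exists_hausdorffMeasure_frontier_inter_ball_le (m : ℕ) (M : ℝ≥0) :
    ∃ K : ℝ≥0, ∀ (Ω : Set (EuclideanSpace ℝ (Fin (m + 1)))), IsOpen Ω →
      ∀ x r, IsLipschitzEpigraphIn M Ω x r →
      ∀ U : ℕ → Set (EuclideanSpace ℝ (Fin (m + 1))), Ω ⊆ ⋃ j, U j →
        Measure.hausdorffMeasure m (frontier Ω ∩ Metric.ball x r) ≤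
          K * ∑' j, if Metric.ediam (U j) = 0 then 0 else Metric.ediam (U j) ^ m := by
  obtain ⟨K, hK⟩ := EuclideanSpace.exists_hausdorffMeasure_le_volume m
  refine ⟨(2 ^ ((1 : ℝ≥0∞) / 2).toReal * max 1 M) ^ m * K, fun Ω hΩ x r hchart U hU => ?_⟩
  obtain ⟨e, φ, hφ, h⟩ := hchart
  change EuclideanSpace ℝ (Fin (m + 1)) ≃ᵢ WithLp 2 (EuclideanSpace ℝ (Fin m) × ℝ) at e
  change EuclideanSpace ℝ (Fin m) → ℝ at φ
  have hg : LipschitzWith (2 ^ ((1 : ℝ≥0∞) / 2).toReal * max 1 M)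
      fun z => e.symm (WithLp.toLp 2 (z, φ z)) := by
    have := e.symm.isometry.lipschitz.comp
      ((WithLp.prod_lipschitzWith_toLp 2 _ _).comp (LipschitzWith.id.prodMk hφ))
    rw [one_mul] at this
    exact this
  set P := (fun y => (e y).fst) '' (frontier Ω ∩ Metric.ball x r) with hP
  have hsub : frontier Ω ∩ Metric.ball x r ⊆ (fun z => e.symm (WithLp.toLp 2 (z, φ z))) '' P := by
    rintro y hy
    refine ⟨_, mem_image_of_mem _ hy, ?_⟩
    have hsnd := snd_eq_of_mem_frontier (f := fun y => (e y).snd) (π := fun y => (e y).fst)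
      ((WithLp.prod_continuous_ofLp 2 _ _).snd.comp e.continuous)
      ((WithLp.prod_continuous_ofLp 2 _ _).fst.comp e.continuous) hφ.continuous hΩ
      Metric.isOpen_ball h hy.1 hy.2
    apply e.injective
    rw [e.apply_symm_apply, ← hsnd]
    rfl
  calc Measure.hausdorffMeasure m (frontier Ω ∩ Metric.ball x r)
      ≤ _ := measure_mono hsub
    _ ≤ _ := hg.hausdorffMeasure_image_le (d := m) (by positivity) P
    _ ≤ _ * (K * ∑' j, if Metric.ediam (U j) = 0 then 0 else Metric.ediam (U j) ^ m) := by
        gcongr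
        exact (hK P).trans (by
          gcongr
          exact volume_image_fst_le e hφ.continuous hΩ Metric.isOpen_ball h hU)
    _ = _ := by
        rw [ENNReal.rpow_natCast, ENNReal.coe_mul _ K, ENNReal.coe_pow, mul_assoc]

theorem exists_le_mixedMeasure (m : ℕ) (M : ℝ≥0) (N : ℕ) :
    ∃ c : ℝ≥0, 0 < c ∧ ∀ Ω : Set (EuclideanSpace ℝ (Fin (m + 1))), IsBoundedLipschitz M N Ω →
      ∀ lam : ℝ, (c : ℝ≥0∞) * (volume Ω +
          ENNReal.ofReal lam * Measure.hausdorffMeasure m (frontier Ω)) ≤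
        mixedMeasure (m + 1) lam Ω := by
  obtain ⟨K, hK⟩ := exists_hausdorffMeasure_frontier_inter_ball_le m M
  refine ⟨(1 + N * K)⁻¹, by positivity, fun Ω hΩ lam => ?_⟩
  obtain ⟨x, r, hxr, hcov⟩ := hΩ.exists_charts
  rw [ENNReal.coe_inv (by positivity), ENNReal.inv_mul_le_iff (by simp)
    ENNReal.coe_ne_top, mixedMeasure, caratheodoryOuterMeasure, OuterMeasure.ofFunction_apply,
    ENNReal.mul_iInf_of_ne (by simp) ENNReal.coe_ne_top]
  refine le_iInf fun U => ?_
  rw [ENNReal.mul_iInf_of_ne (by simp) ENNReal.coe_ne_top]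
  refine le_iInf fun hU => ?_
  set S := ∑' j, (if Metric.ediam (U j) = 0 then 0 else Metric.ediam (U j) ^ m) with hS
  set T := ∑' j, Metric.ediam (U j) ^ (m + 1) with hT
  have hvol : volume Ω ≤ T := (measure_mono hU).trans <| (measure_iUnion_le _).trans <|
    ENNReal.tsum_le_tsum fun j => EuclideanSpace.volume_le_ediam_pow _
  have hH : Measure.hausdorffMeasure m (frontier Ω) ≤ N * K * S := by
    calc Measure.hausdorffMeasure m (frontier Ω)
        ≤ Measure.hausdorffMeasure m (⋃ i, frontier Ω ∩ Metric.ball (x i) (r i)) := by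
          rw [← inter_iUnion]
          exact measure_mono (subset_inter subset_rfl hcov)
      _ ≤ ∑' i, Measure.hausdorffMeasure m (frontier Ω ∩ Metric.ball (x i) (r i)) :=
          measure_iUnion_le _
      _ ≤ ∑' _ : Fin N, K * S := ENNReal.tsum_le_tsum fun i =>
          hK Ω hΩ.isOpen _ _ (hxr i).2.2 U hU
      _ = N * K * S := by rw [tsum_fintype]; simp [mul_assoc]
  calc volume Ω + ENNReal.ofReal lam * Measure.hausdorffMeasure m (frontier Ω)
      ≤ T + ENNReal.ofReal lam * (N * K * S) := by gcongr
    -- The added terms complete the product `(1 + N * K) * (T + lam * S)`, whence the choice of `c`.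
    _ ≤ (T + ENNReal.ofReal lam * (N * K * S)) + (N * K * T + ENNReal.ofReal lam * S) :=
        le_self_add
    _ = (1 + N * K) * (T + ENNReal.ofReal lam * S) := by ring
    _ = _ := by
        rw [hT, hS, ← ENNReal.tsum_mul_left, ← ENNReal.tsum_add]
        simp only [mixedGauge_succ]
        push_cast
        rfl

end LowerBound

theorem corollary4p3 (n : ℕ) (hn : 1 ≤ n) (M : ℝ≥0) (N : ℕ) :
    ∃ c C : ℝ≥0, 0 < c ∧ 0 < C ∧
      ∀ (Ω : Set (EuclideanSpace ℝ (Fin n))), IsBoundedLipschitz M N Ω →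
      ∀ lam : ℝ, 0 < lam →
        (c : ℝ≥0∞) * (volume Ω +
            ENNReal.ofReal lam * Measure.hausdorffMeasure ((n : ℝ) - 1) (frontier Ω)) ≤
          mixedMeasure n lam Ω ∧
        mixedMeasure n lam Ω ≤
          (C : ℝ≥0∞) * (volume Ω +
            ENNReal.ofReal lam * Measure.hausdorffMeasure ((n : ℝ) - 1) (frontier Ω)) := by
  obtain ⟨m, rfl⟩ := Nat.exists_eq_add_of_le' hn
  obtain ⟨c, hc, hlow⟩ := exists_le_mixedMeasure m M N
  obtain ⟨C, hC, hup⟩ := exists_mixedMeasure_le m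
  have hm : ((m + 1 : ℕ) : ℝ) - 1 = m := by push_cast; ring
  rw [hm]
  exact ⟨c, C, hc, hC, fun Ω hΩ lam _ => ⟨hlow Ω hΩ lam, hup Ω hΩ.isOpen hΩ.isBounded lam⟩⟩
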